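/- Let $H(\mathbb{C})$ be the space of entire functions, with the topology given by the seminorms $\|f\|_k=\sup_{|z|\le k}|f(z)|$, $k\in\mathbb{N}$, and let $D\colon H(\mathbb{C})\to H(\mathbb{C})$, $Df=f'$. The upper density of $A\subset\mathbb{N}$ is $\overline{\mathrm{dens}}(A)=\limsup_{n\to\infty}|A\cap\{1,\dots,n\}|/n$. An entire function $f$ is called $D$-distributionally irregular if - there exist $m\in\mathbb{N}$ and $B\subset\mathbb{N}$ with $\overline{\mathrm{dens}}(B)=1$ such that $\lim_{n\to\infty,\,n\in B}\|D^nf\|_m=\infty$, and - there exists $A\subset\mathbb{N}$ with $\overline{\mathrm{dens}}(A)=1$ such that $\lim_{n\to\infty,\,n\in A}D^nf=0$ in $H(\mathbb{C})$, i.e. $\lim_{n\to\infty,\,n\in A}\|D^nf\|_k=0$ for every $k$. For an entire function $f$ and $r>0$ put $$M_p(f,r)=\left(\frac1{2\pi}\int_0^{2\pi}|f(re^{it})|^p\,dt\right)^{1/p}\quad(1\le p<\infty),\qquad M_\infty(f,r)=\sup_{|z|=r}|f(z)|.$$ **Theorem.** Let $1\le p\le\infty$. (i) Let $a=\dfrac{1}{2\max\{2,p\}}$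 (so $a=0$ if $p=\infty$). For every function $\varphi\colon(0,\infty)\to(0,\infty)$ with $\varphi(r)\to\infty$ as $r\to\infty$ there exists a $D$-distributionally irregular entire function $f$ such that $$M_p(f,r)\le\varphi(r)\frac{e^r}{r^a}\quad\text{for all sufficiently large } r>0.$$ (ii) Let $a=\dfrac{1}{2\min\{2,p\}}$. There is no $D$-distributionally irregular entire function $f$ for which there is a constant $c>0$ with $$M_p(f,r)\le c\,\frac{e^r}{r^a}\quad\text{for all sufficiently large } r>0.$$ -/

import Mathlib

open Filter Topology
open scoped ENNReal

/-- The upper density `limsup |A ∩ {1, …, n}| / n` of a set of natural numbers. -/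
noncomputable def upperDensity (A : Set ℕ) : ℝ :=
  limsup (fun n : ℕ => ((A ∩ Set.Icc 1 n).ncard : ℝ) / (n : ℝ)) atTop

section Irregular

variable {X : Type*} [AddCommGroup X] [Module ℂ X]

/-- The `T`-orbit of `x` is distributionally near to `0`: `T ^ n x → 0` as `n → ∞` along some
set `A` of upper density one. Here `X` carries the topology generated by the seminorms `q k`, so
a sequence tends to `0` exactly when each seminorm of it does. -/
def DistributionallyNearZero (q : ℕ → Seminorm ℂ X) (T : X →ₗ[ℂ] X) (x : X) : Prop :=
  ∃ A : Set ℕ, upperDensity A = 1 ∧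
    ∀ k : ℕ, Tendsto (fun n : ℕ => q k ((T ^ n) x)) (atTop ⊓ 𝓟 A) (𝓝 0)

/-- The `T`-orbit of `x` is distributionally unbounded: some seminorm of `T ^ n x` tends to
infinity as `n → ∞` along some set `B` of upper density one. -/
def DistributionallyUnbounded (q : ℕ → Seminorm ℂ X) (T : X →ₗ[ℂ] X) (x : X) : Prop :=
  ∃ m : ℕ, ∃ B : Set ℕ, upperDensity B = 1 ∧
    Tendsto (fun n : ℕ => q m ((T ^ n) x)) (atTop ⊓ 𝓟 B) atTop

/-- `x` is a distributionally irregular vector for `T`. -/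
def DistributionallyIrregular (q : ℕ → Seminorm ℂ X) (T : X →ₗ[ℂ] X) (x : X) : Prop :=
  DistributionallyUnbounded q T x ∧ DistributionallyNearZero q T x

end Irregular

/-- The space `H(ℂ)` of entire functions. -/
def EntireFunctions : Submodule ℂ (ℂ → ℂ) where
  carrier := {f | Differentiable ℂ f}
  add_mem' hf hg := Differentiable.add hf hg
  zero_mem' := differentiable_const (0 : ℂ)
  smul_mem' c _ hf := Differentiable.const_smul hf c

theorem EntireFunctions.bddAbove (f : EntireFunctions) (k : ℕ) :
    BddAbove (Set.range fun z : Metric.closedBall (0 : ℂ) k => ‖f.1 z‖) := by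
  have h := (isCompact_closedBall (0 : ℂ) (k : ℝ)).bddAbove_image
    (f := fun z => ‖f.1 z‖) (Differentiable.continuous f.2).norm.continuousOn
  rwa [Set.image_eq_range] at h

/-- The seminorms `‖f‖_k = sup_{|z| ≤ k} |f z|` of uniform convergence on compact sets, which
define the usual Fréchet space topology on `H(ℂ)`. -/
noncomputable def entireSeminorm (k : ℕ) : Seminorm ℂ EntireFunctions :=
  Seminorm.of (fun f => ⨆ z : Metric.closedBall (0 : ℂ) k, ‖f.1 z‖)
    (fun f g => by
      have : Nonempty (Metric.closedBall (0 : ℂ) (k : ℝ)) := ⟨⟨0, by simp⟩⟩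
      refine ciSup_le fun z => (norm_add_le (f.1 z) (g.1 z)).trans ?_
      exact add_le_add (le_ciSup (EntireFunctions.bddAbove f k) z) (le_ciSup (EntireFunctions.bddAbove g k) z))
    (fun c f => by
      have h : ∀ z : Metric.closedBall (0 : ℂ) (k : ℝ), ‖(c • f).1 z‖ = ‖c‖ * ‖f.1 z‖ :=
        fun z => norm_mul c (f.1 z)
      simp only [h]
      exact (Real.mul_iSup_of_nonneg (norm_nonneg c) _).symm)

/-- The differentiation operator `D f = f'` on `H(ℂ)`. -/
noncomputable def diffOp : EntireFunctions →ₗ[ℂ] EntireFunctions where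
  toFun f := ⟨deriv f.1, Differentiable.deriv f.2⟩
  map_add' f g := Subtype.ext <| funext fun z => deriv_add (f.2 z) (g.2 z)
  map_smul' c f := Subtype.ext <| funext fun z => deriv_const_smul c (f.2 z)

/-- The average `L^p`-norm `M_p(f, r)` of `f` on the circle `|z| = r`; for `p = ∞` the sup-norm. -/
noncomputable def avgNorm (p : ℝ≥0∞) (f : ℂ → ℂ) (r : ℝ) : ℝ :=
  if p = ∞ then sSup ((fun z : ℂ => ‖f z‖) '' {z : ℂ | ‖z‖ = r})
  else ((1 / (2 * Real.pi)) * ∫ t in (0 : ℝ)..(2 * Real.pi),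
    ‖f (r * Complex.exp (t * Complex.I))‖ ^ p.toReal) ^ (1 / p.toReal)

/-! Write `a n` for the `n`-th derivative of `f` at `0`. Then `D` shifts the sequence `a`, so `‖D^n
f‖_m` is at least `|a n|` and at most `∑ j, |a (n + j)| m^j / j!`. Both parts become questions about
`a`.

Nonexistence. Means increase with `p`, so let `p ≤ 2`. At radius `k^2` the weights `n! / r^n` stay
below a constant times `k e^{-k^2}` on the window `k^2 ≤ n < (k+1)^2`. Pairing `f` with a
trigonometric polynomial supported there, whose conjugate norm is interpolated between Parseval and
the sup bound, gives `∑ |a n| = O(k)` over the window (`sum_window_le`). The windows tile the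
integers, so the averages of `|a n|`, hence those of `‖D^n f‖_m`, are bounded. This excludes
divergence to infinity along a set of upper density one.

Existence. Let `a` equal `k` on the `k`-th block for odd `k` and `0` for even `k`, with blocks so
long that each outweighs all earlier ones. The odd blocks give unboundedness, the even ones decay.
If the blocks start late enough relative to `φ`, then `∑ (a n)^2 r^n / n! ≤ φ(r) e^r`. This bounds
the supremum; with Parseval and `r^n / n! ≤ e^r / √r` it bounds the quadratic mean, and
interpolation handles all `p ≥ 2`. One function serves every `p`. -/

/-! ### Absolutely convergent Fourier series and Parseval's identity. -/

section Fourier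

open MeasureTheory Complex

theorem integral_exp_I_pow_mul_conj_pow (n k : ℕ) :
    ∫ t in (0 : ℝ)..(2 * Real.pi), exp (t * I) ^ n * (starRingEnd ℂ) (exp (t * I) ^ k) =
      if n = k then 2 * Real.pi else 0 := by
  have h : ∀ t : ℝ, exp (t * I) ^ n * (starRingEnd ℂ) (exp (t * I) ^ k) =
      exp ((((n : ℤ) - (k : ℤ) : ℤ) : ℂ) * I * t) := by
    intro t
    rw [← exp_nat_mul, ← exp_nat_mul, ← exp_conj, ← exp_add]
    congr 1
    simp only [map_mul, map_natCast, conj_ofReal, conj_I]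
    push_cast
    ring
  simp_rw [h]
  split_ifs with hnk
  · subst hnk
    simp
  · have hc : (((n : ℤ) - (k : ℤ) : ℤ) : ℂ) ≠ 0 := by
      rw [Int.cast_ne_zero]
      omega
    rw [integral_exp_mul_complex (mul_ne_zero hc I_ne_zero)]
    have : (((n : ℤ) - (k : ℤ) : ℤ) : ℂ) * I * ((2 * Real.pi : ℝ) : ℂ) =
        (((n : ℤ) - (k : ℤ) : ℤ) : ℂ) * (2 * Real.pi * I) := by
      push_cast
      ring
    rw [this, exp_int_mul_two_pi_mul_I]
    simp

theorem summable_mul_exp_I_pow {c : ℕ → ℂ} (hc : Summable fun n => ‖c n‖) (t : ℝ) :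
    Summable fun n => c n * exp (t * I) ^ n :=
  Summable.of_norm (by simpa [norm_exp_ofReal_mul_I] using hc)

theorem continuous_tsum_mul_exp_I_pow {c : ℕ → ℂ} (hc : Summable fun n => ‖c n‖) :
    Continuous fun t : ℝ => ∑' n, c n * exp (t * I) ^ n :=
  continuous_tsum (fun n => by fun_prop) hc (fun n t => by simp [norm_exp_ofReal_mul_I])

/-- An absolutely convergent Fourier series may be integrated termwise against a continuous
function. -/
theorem hasSum_integral_mul_exp_I_pow {c : ℕ → ℂ} (hc : Summable fun n => ‖c n‖) {h : ℝ → ℂ}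
    (hh : Continuous h) :
    HasSum (fun n => c n * ∫ t in (0 : ℝ)..(2 * Real.pi), exp (t * I) ^ n * h t)
      (∫ t in (0 : ℝ)..(2 * Real.pi), (∑' n, c n * exp (t * I) ^ n) * h t) := by
  have := intervalIntegral.hasSum_integral_of_dominated_convergence (a := 0) (b := 2 * Real.pi)
    (μ := volume) (F := fun n t => c n * (exp (t * I) ^ n * h t))
    (f := fun t => (∑' n, c n * exp (t * I) ^ n) * h t)
    (fun n t => ‖c n‖ * ‖h t‖) (fun n => ?_) (fun n => ?_) ?_ ?_ ?_
  · simpa [intervalIntegral.integral_const_mul] using this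
  · exact Continuous.aestronglyMeasurable (by fun_prop)
  · exact Eventually.of_forall fun t _ => by simp [norm_exp_ofReal_mul_I]
  · exact Eventually.of_forall fun t _ => hc.mul_right _
  · simp_rw [tsum_mul_right]
    exact Continuous.intervalIntegrable (by fun_prop) _ _
  · refine Eventually.of_forall fun t _ => ?_
    simpa [mul_assoc] using (summable_mul_exp_I_pow hc t).hasSum.mul_right (h t)

theorem integral_tsum_mul_conj_pow {c : ℕ → ℂ} (hc : Summable fun n => ‖c n‖) (k : ℕ) :
    ∫ t in (0 : ℝ)..(2 * Real.pi),
      (∑' n, c n * exp (t * I) ^ n) * (starRingEnd ℂ) (exp (t * I) ^ k) = 2 * Real.pi * c k := by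
  have h := hasSum_integral_mul_exp_I_pow hc
    (h := fun t => (starRingEnd ℂ) (exp (t * I) ^ k)) (by fun_prop)
  simp_rw [integral_exp_I_pow_mul_conj_pow] at h
  have h2 := hasSum_ite_eq k (2 * Real.pi * c k : ℂ)
  refine h.unique (h2.congr_fun ?_)
  intro n
  split_ifs with hn
  · subst hn
    push_cast
    ring
  · simp

/-- Parseval's identity for absolutely convergent Fourier series. -/
theorem integral_norm_sq_tsum {c : ℕ → ℂ} (hc : Summable fun n => ‖c n‖) :
    HasSum (fun n => 2 * Real.pi * ‖c n‖ ^ 2)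
      (∫ t in (0 : ℝ)..(2 * Real.pi), ‖∑' n, c n * exp (t * I) ^ n‖ ^ 2) := by
  have h := hasSum_integral_mul_exp_I_pow hc
    (h := fun t => (starRingEnd ℂ) (∑' n, c n * exp (t * I) ^ n))
    (continuous_conj.comp (continuous_tsum_mul_exp_I_pow hc))
  have key : ∀ k : ℕ, ∫ t in (0 : ℝ)..(2 * Real.pi),
      exp (t * I) ^ k * (starRingEnd ℂ) (∑' n, c n * exp (t * I) ^ n) =
        2 * Real.pi * (starRingEnd ℂ) (c k) := by
    intro k
    have := congrArg (starRingEnd ℂ) (integral_tsum_mul_conj_pow hc k)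
    rw [← intervalIntegral.intervalIntegral_conj] at this
    simp only [map_mul, map_pow, conj_conj, conj_ofReal, Complex.conj_ofNat] at this ⊢
    simpa only [mul_comm] using this
  simp_rw [key, mul_conj, normSq_eq_norm_sq] at h
  rw [intervalIntegral.integral_ofReal] at h
  rw [← hasSum_ofReal]
  refine h.congr_fun fun n => ?_
  have := mul_conj (c n)
  rw [normSq_eq_norm_sq] at this
  push_cast at this ⊢
  linear_combination (-2 * Real.pi : ℂ) * this

end Fourier

/-! ### The means `M_p` as norms over a probability measure. -/

section AvgNorm

open MeasureTheory

/-- The normalized Lebesgue measure on `(0, 2π]`. -/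
noncomputable def angleMeasure : Measure ℝ :=
  ENNReal.ofReal (1 / (2 * Real.pi)) • volume.restrict (Set.Ioc 0 (2 * Real.pi))

instance : IsProbabilityMeasure angleMeasure := by
  constructor
  simp only [angleMeasure, Measure.smul_apply, Measure.restrict_apply_univ, Real.volume_Ioc,
    sub_zero, smul_eq_mul]
  rw [← ENNReal.ofReal_mul (by positivity), one_div_mul_cancel (by positivity), ENNReal.ofReal_one]

theorem integral_angleMeasure (g : ℝ → ℝ) :
    ∫ t, g t ∂angleMeasure = 1 / (2 * Real.pi) * ∫ t in (0 : ℝ)..(2 * Real.pi), g t := by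
  rw [angleMeasure, integral_smul_measure, intervalIntegral.integral_of_le (by positivity),
    ENNReal.toReal_ofReal (by positivity), smul_eq_mul]

theorem memLp_angleMeasure {E : Type*} [NormedAddCommGroup E] [SecondCountableTopology E]
    {g : ℝ → E} (hg : Continuous g) (p : ℝ≥0∞) : MemLp g p angleMeasure := by
  obtain ⟨C, hC⟩ := (isCompact_Icc (a := (0 : ℝ)) (b := 2 * Real.pi)).exists_bound_of_continuousOn
    hg.continuousOn
  refine MemLp.of_bound hg.aestronglyMeasurable C ?_
  refine Measure.ae_smul_measure ?_ _
  filter_upwards [ae_restrict_mem measurableSet_Ioc] with t ht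
  exact hC t (Set.Ioc_subset_Icc_self ht)

theorem continuous_circle_comp {f : ℂ → ℂ} (hf : Continuous f) (r : ℝ) :
    Continuous fun t : ℝ => f (r * Complex.exp (t * Complex.I)) := by
  fun_prop

theorem avgNorm_nonneg (p : ℝ≥0∞) (f : ℂ → ℂ) (r : ℝ) : 0 ≤ avgNorm p f r := by
  rw [avgNorm]
  split_ifs
  · exact Real.sSup_nonneg (by rintro _ ⟨z, -, rfl⟩; exact norm_nonneg _)
  · have : 0 ≤ ∫ t in (0 : ℝ)..(2 * Real.pi),
        ‖f (r * Complex.exp (t * Complex.I))‖ ^ p.toReal :=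
      intervalIntegral.integral_nonneg (by positivity) fun t _ => by positivity
    positivity

theorem avgNorm_eq_toReal_eLpNorm {p : ℝ≥0∞} (h0 : p ≠ 0) (hp : p ≠ ∞) {f : ℂ → ℂ}
    (hf : Continuous f) (r : ℝ) :
    avgNorm p f r =
      (eLpNorm (fun t : ℝ => f (r * Complex.exp (t * Complex.I))) p angleMeasure).toReal := by
  rw [(memLp_angleMeasure (continuous_circle_comp hf r) p).eLpNorm_eq_integral_rpow_norm h0 hp,
    ENNReal.toReal_ofReal, integral_angleMeasure, avgNorm, if_neg hp, one_div p.toReal]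
  exact Real.rpow_nonneg (integral_nonneg fun t => by positivity) _

theorem norm_le_avgNorm_top {f : ℂ → ℂ} (hf : Continuous f) {r : ℝ} {z : ℂ} (hz : ‖z‖ = r) :
    ‖f z‖ ≤ avgNorm ∞ f r := by
  rw [avgNorm, if_pos rfl]
  refine le_csSup ?_ ⟨z, hz, rfl⟩
  have : {z : ℂ | ‖z‖ = r} = Metric.sphere 0 r := by ext; simp
  rw [this]
  exact ((isCompact_sphere (0 : ℂ) r).image hf.norm).bddAbove

theorem avgNorm_top_le {f : ℂ → ℂ} {r M : ℝ} (hM : 0 ≤ M) (h : ∀ z : ℂ, ‖z‖ = r → ‖f z‖ ≤ M) :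
    avgNorm ∞ f r ≤ M := by
  rw [avgNorm, if_pos rfl]
  exact Real.sSup_le (by rintro _ ⟨z, hz, rfl⟩; exact h z hz) hM

/-- Jensen's inequality on a probability space. It reduces existence to exponents `≥ 2` and
nonexistence to exponents `≤ 2`. -/
theorem avgNorm_mono {p q : ℝ≥0∞} (hp : p ≠ 0) (hpq : p ≤ q) {f : ℂ → ℂ} (hf : Continuous f)
    {r : ℝ} (hr : 0 ≤ r) : avgNorm p f r ≤ avgNorm q f r := by
  by_cases hp' : p = ∞
  · subst hp'
    rw [top_le_iff.1 hpq]
  rw [avgNorm_eq_toReal_eLpNorm hp hp' hf]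
  by_cases hq : q = ∞
  · subst hq
    refine ENNReal.toReal_le_of_le_ofReal (avgNorm_nonneg _ _ _) ?_
    refine (eLpNorm_le_of_ae_bound (C := avgNorm ∞ f r) (Eventually.of_forall fun t => ?_)).trans ?_
    · exact norm_le_avgNorm_top hf (by simp [Complex.norm_exp_ofReal_mul_I, abs_of_nonneg hr])
    · simp
  · rw [avgNorm_eq_toReal_eLpNorm (fun h => hp (by simpa [h] using hpq)) hq hf]
    exact ENNReal.toReal_mono (memLp_angleMeasure (continuous_circle_comp hf r) q).eLpNorm_ne_top
      (eLpNorm_le_eLpNorm_of_exponent_le hpq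
        (continuous_circle_comp hf r).aestronglyMeasurable)

theorem avgNorm_eq_integral {p : ℝ≥0∞} (hp : p ≠ ∞) (f : ℂ → ℂ) (r : ℝ) :
    avgNorm p f r = (∫ t, ‖f (r * Complex.exp (t * Complex.I))‖ ^ p.toReal ∂angleMeasure) ^
      (1 / p.toReal) := by
  rw [avgNorm, if_neg hp, integral_angleMeasure]

/-- Interpolation between the mean of order two and the supremum. -/
theorem avgNorm_le_of_two_le {p : ℝ≥0∞} (h2 : 2 ≤ p) (hp : p ≠ ∞) {f : ℂ → ℂ}
    (hf : Continuous f) {r M A : ℝ} (hr : 0 ≤ r) (hM : ∀ z : ℂ, ‖z‖ = r → ‖f z‖ ≤ M)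
    (hA : ∫ t, ‖f (r * Complex.exp (t * Complex.I))‖ ^ 2 ∂angleMeasure ≤ A) :
    avgNorm p f r ≤ (M ^ (p.toReal - 2) * A) ^ (1 / p.toReal) := by
  have h2' : 2 ≤ p.toReal := by
    simpa using ENNReal.toReal_mono hp h2
  have hF := (continuous_circle_comp hf r).norm
  have hle : ∀ t : ℝ, ‖f (r * Complex.exp (t * Complex.I))‖ ≤ M := fun t =>
    hM _ (by simp [Complex.norm_exp_ofReal_mul_I, abs_of_nonneg hr])
  have hM0 : 0 ≤ M := (norm_nonneg _).trans (hle 0)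
  rw [avgNorm_eq_integral hp]
  refine Real.rpow_le_rpow (integral_nonneg fun t => by positivity) ?_ (by positivity)
  calc _ ≤ ∫ t, M ^ (p.toReal - 2) * ‖f (r * Complex.exp (t * Complex.I))‖ ^ 2 ∂angleMeasure := by
        refine integral_mono_of_nonneg (Eventually.of_forall fun t => by positivity) ?_
          (Eventually.of_forall fun t => ?_)
        · exact memLp_one_iff_integrable.1 (memLp_angleMeasure (by fun_prop) 1)
        · dsimp only
          have : p.toReal = (p.toReal - 2) + (2 : ℕ) := by push_cast; ring
          nth_rw 1 [this]
          rw [Real.rpow_add_natCast' (norm_nonneg _) (by push_cast; linarith)]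
          gcongr
          · exact hle t
    _ ≤ _ := by
        rw [integral_const_mul]
        gcongr

end AvgNorm

/-! ### Taylor coefficients and the seminorms of derivatives. -/

section Coefficients

open Complex

theorem diffOp_pow_apply (f : EntireFunctions) (n : ℕ) :
    ((diffOp ^ n) f).1 = iteratedDeriv n f.1 := by
  induction n generalizing f with
  | zero => simp
  | succ n ih =>
    rw [pow_succ, Module.End.mul_apply, ih, iteratedDeriv_succ']
    rfl

theorem iteratedDeriv_diffOp_pow (f : EntireFunctions) (n j : ℕ) :
    iteratedDeriv j ((diffOp ^ n) f).1 = iteratedDeriv (n + j) f.1 := by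
  rw [← diffOp_pow_apply, ← diffOp_pow_apply, add_comm, pow_add, Module.End.mul_apply]

theorem EntireFunctions.hasSum (f : EntireFunctions) (z : ℂ) :
    HasSum (fun n => iteratedDeriv n f.1 0 / n.factorial * z ^ n) (f.1 z) := by
  refine (Complex.hasSum_taylorSeries_of_entire f.2 0 z).congr_fun fun n => ?_
  simp only [sub_zero, smul_eq_mul]
  ring

theorem EntireFunctions.summable_norm (f : EntireFunctions) (r : ℝ) :
    Summable fun n => ‖iteratedDeriv n f.1 0 / n.factorial * (r : ℂ) ^ n‖ :=
  (EntireFunctions.hasSum f r).summable.norm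

theorem EntireFunctions.circle_eq_tsum (f : EntireFunctions) (r t : ℝ) :
    f.1 (r * exp (t * I)) =
      ∑' n, iteratedDeriv n f.1 0 / n.factorial * (r : ℂ) ^ n * exp (t * I) ^ n := by
  rw [← (EntireFunctions.hasSum f _).tsum_eq]
  refine tsum_congr fun n => ?_
  rw [mul_pow, mul_assoc]

theorem EntireFunctions.summable_coeff (f : EntireFunctions) (m : ℕ) :
    Summable fun n => ‖iteratedDeriv n f.1 0‖ * ((m : ℝ) ^ n / n.factorial) := by
  refine (EntireFunctions.summable_norm f m).congr fun n => ?_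
  simp only [norm_mul, norm_div, norm_pow, Complex.norm_natCast, ofReal_natCast]
  ring

theorem EntireFunctions.norm_le_tsum (f : EntireFunctions) {z : ℂ} {m : ℕ} (hz : ‖z‖ ≤ m) :
    ‖f.1 z‖ ≤ ∑' n, ‖iteratedDeriv n f.1 0‖ * ((m : ℝ) ^ n / n.factorial) := by
  rw [← (EntireFunctions.hasSum f z).tsum_eq]
  refine tsum_of_norm_bounded (EntireFunctions.summable_coeff f m).hasSum fun n => ?_
  simp only [norm_mul, norm_div, norm_pow, Complex.norm_natCast]
  rw [div_mul_eq_mul_div, mul_div_assoc]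
  gcongr

theorem entireSeminorm_le_tsum (f : EntireFunctions) (m : ℕ) :
    entireSeminorm m f ≤ ∑' n, ‖iteratedDeriv n f.1 0‖ * ((m : ℝ) ^ n / n.factorial) := by
  have : Nonempty (Metric.closedBall (0 : ℂ) (m : ℝ)) := ⟨⟨0, by simp⟩⟩
  exact ciSup_le fun z => EntireFunctions.norm_le_tsum f (mem_closedBall_zero_iff.1 z.2)

theorem norm_apply_zero_le_entireSeminorm (f : EntireFunctions) (m : ℕ) :
    ‖f.1 0‖ ≤ entireSeminorm m f :=
  le_ciSup (EntireFunctions.bddAbove f m) ⟨0, by simp⟩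

theorem entireSeminorm_diffOp_pow_le (f : EntireFunctions) (m n : ℕ) :
    entireSeminorm m ((diffOp ^ n) f) ≤
      ∑' j, ‖iteratedDeriv (n + j) f.1 0‖ * ((m : ℝ) ^ j / j.factorial) := by
  refine (entireSeminorm_le_tsum _ m).trans_eq ?_
  simp_rw [iteratedDeriv_diffOp_pow]

theorem summable_coeff_diffOp_pow (f : EntireFunctions) (m n : ℕ) :
    Summable fun j => ‖iteratedDeriv (n + j) f.1 0‖ * ((m : ℝ) ^ j / j.factorial) := by
  simpa only [iteratedDeriv_diffOp_pow] using EntireFunctions.summable_coeff ((diffOp ^ n) f) m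

end Coefficients

/-! ### Upper density and bounded averages. -/

section Density

theorem count_div_nonneg (A : Set ℕ) (n : ℕ) :
    0 ≤ ((A ∩ Set.Icc 1 n).ncard : ℝ) / (n : ℝ) := by positivity

theorem count_div_le_one (A : Set ℕ) (n : ℕ) :
    ((A ∩ Set.Icc 1 n).ncard : ℝ) / (n : ℝ) ≤ 1 := by
  refine div_le_one_of_le₀ ?_ (Nat.cast_nonneg n)
  have := Set.ncard_le_ncard (s := A ∩ Set.Icc 1 n) (t := Set.Icc 1 n) Set.inter_subset_right
    (Set.finite_Icc 1 n)
  have h2 : (Set.Icc 1 n).ncard = n := by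
    rw [← Finset.coe_Icc, Set.ncard_coe_finset, Nat.card_Icc]
    simp
  exact_mod_cast this.trans_eq h2

theorem upperDensity_eq_one {A : Set ℕ}
    (h : ∀ ε > 0, ∃ᶠ n : ℕ in atTop, 1 - ε ≤ ((A ∩ Set.Icc 1 n).ncard : ℝ) / (n : ℝ)) :
    upperDensity A = 1 := by
  have hb : IsBoundedUnder (· ≤ ·) atTop
      (fun n : ℕ => ((A ∩ Set.Icc 1 n).ncard : ℝ) / (n : ℝ)) :=
    isBoundedUnder_of ⟨1, count_div_le_one A⟩
  refine le_antisymm ?_ ?_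
  · exact limsup_le_of_le (IsBoundedUnder.isCoboundedUnder_le
      (isBoundedUnder_of ⟨0, count_div_nonneg A⟩)) (Eventually.of_forall (count_div_le_one A))
  · refine le_of_forall_pos_sub_le fun ε hε => ?_
    exact le_limsup_of_frequently_le (h ε hε) hb

/-- A nonnegative sequence that tends to infinity along a set of upper density one has unbounded
averages. -/
theorem not_sum_le_mul_of_tendsto_atTop {B : Set ℕ} (hB : upperDensity B = 1) {b : ℕ → ℝ}
    (hb : ∀ n, 0 ≤ b n) (h : Tendsto b (atTop ⊓ 𝓟 B) atTop) (C : ℝ) :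
    ¬ ∀ N : ℕ, 1 ≤ N → ∑ n ∈ Finset.Icc 1 N, b n ≤ C * N := by
  classical
  intro hC
  -- For suitable large `N`, more than `N / 2` points of `B` lie in `[1, N]`. Discarding those below
  -- `n₀ < N / 4` leaves over `N / 4` terms, each at least `4|C| + 4`, with sum above `C N`.
  have h1 := h.eventually_ge_atTop (4 * |C| + 4)
  rw [eventually_inf_principal] at h1
  obtain ⟨n₀, hn₀⟩ := eventually_atTop.1 h1
  have h2 : ∃ᶠ n : ℕ in atTop, (1 : ℝ) / 2 < ((B ∩ Set.Icc 1 n).ncard : ℝ) / (n : ℝ) := by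
    refine frequently_lt_of_lt_limsup (IsBoundedUnder.isCoboundedUnder_le
      (isBoundedUnder_of ⟨0, count_div_nonneg B⟩)) ?_
    change (1 : ℝ) / 2 < upperDensity B
    rw [hB]
    norm_num
  obtain ⟨N, hN, hcount⟩ := frequently_atTop.1 h2 (4 * n₀ + 1)
  have hNpos : (0 : ℝ) < N := by exact_mod_cast (by omega : 0 < N)
  rw [lt_div_iff₀ hNpos] at hcount
  have hset : B ∩ Set.Icc 1 N = ((Finset.Icc 1 N).filter (· ∈ B) : Finset ℕ) := by
    ext n
    simp only [Set.mem_inter_iff, Set.mem_Icc, Finset.coe_filter, Finset.mem_Icc,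
      Set.mem_ofPred_eq]
    tauto
  rw [hset, Set.ncard_coe_finset] at hcount
  have hsub : (Finset.Icc 1 N).filter (· ∈ B) ⊆
      Finset.range n₀ ∪ (Finset.Icc 1 N).filter (fun n => n ∈ B ∧ n₀ ≤ n) := by
    intro n hn
    simp only [Finset.mem_filter, Finset.mem_union, Finset.mem_range] at hn ⊢
    by_cases hlt : n < n₀
    · exact Or.inl hlt
    · exact Or.inr ⟨hn.1, hn.2, not_lt.1 hlt⟩
  have hcard := (Finset.card_le_card hsub).trans (Finset.card_union_le _ _)
  rw [Finset.card_range] at hcard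
  have hcard' : (((Finset.Icc 1 N).filter (· ∈ B)).card : ℝ) ≤
      n₀ + ((Finset.Icc 1 N).filter (fun n => n ∈ B ∧ n₀ ≤ n)).card := by exact_mod_cast hcard
  have hN' : (4 * n₀ + 1 : ℝ) ≤ N := by exact_mod_cast hN
  have hsum : ((Finset.Icc 1 N).filter (fun n => n ∈ B ∧ n₀ ≤ n)).card * (4 * |C| + 4) ≤
      ∑ n ∈ Finset.Icc 1 N, b n := by
    rw [← nsmul_eq_mul]
    refine (Finset.card_nsmul_le_sum _ b _ fun n hn => ?_).trans
      (Finset.sum_le_sum_of_subset_of_nonneg (Finset.filter_subset _ _) fun n _ _ => hb n)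
    simp only [Finset.mem_filter] at hn
    exact hn₀ n hn.2.2 hn.2.1
  have hfin := hsum.trans (hC N (by omega))
  have hCabs := mul_le_mul_of_nonneg_right (le_abs_self C) hNpos.le
  have h3 : (N : ℝ) / 4 * (4 * |C| + 4) ≤
      ((Finset.Icc 1 N).filter (fun n => n ∈ B ∧ n₀ ≤ n)).card * (4 * |C| + 4) := by
    gcongr
    linarith
  linarith

theorem summable_natCast_mul_pow_div_factorial (x : ℝ) :
    Summable fun j : ℕ => (j : ℝ) * (x ^ j / j.factorial) := by
  rw [← summable_nat_add_iff 1]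
  refine ((Real.summable_pow_div_factorial x).mul_left x).congr fun j => ?_
  rw [Nat.factorial_succ]
  push_cast
  field_simp
  ring

/-- If the coefficients of an entire function have bounded averages, then its orbit under
differentiation is not distributionally unbounded. -/
theorem not_distributionallyUnbounded_of_sum_le {f : EntireFunctions} {C : ℝ} (hC0 : 0 ≤ C)
    (hC : ∀ N : ℕ, ∑ n ∈ Finset.range N, ‖iteratedDeriv n f.1 0‖ ≤ C * (N + 1)) :
    ¬ DistributionallyUnbounded entireSeminorm diffOp f := by
  rintro ⟨m, B, hB, h⟩
  set w : ℕ → ℝ := fun j => (m : ℝ) ^ j / j.factorial with hw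
  have hw0 : ∀ j, 0 ≤ w j := fun j => by positivity
  -- The shift by `j` costs `C (N + j + 2) ≤ C N (j + 3)` for `N ≥ 1`.
  have hs : Summable fun j : ℕ => ((j : ℝ) + 3) * w j := by
    refine ((summable_natCast_mul_pow_div_factorial m).add
      ((Real.summable_pow_div_factorial m).mul_left 3)).congr fun j => ?_
    simp only [hw]
    ring
  refine not_sum_le_mul_of_tendsto_atTop hB (fun n => apply_nonneg _ _) h
    (C * ∑' j : ℕ, ((j : ℝ) + 3) * w j) fun N hN => ?_
  calc ∑ n ∈ Finset.Icc 1 N, entireSeminorm m ((diffOp ^ n) f)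
      ≤ ∑ n ∈ Finset.Icc 1 N, ∑' j, ‖iteratedDeriv (n + j) f.1 0‖ * w j :=
        Finset.sum_le_sum fun n _ => entireSeminorm_diffOp_pow_le f m n
    _ = ∑' j, ∑ n ∈ Finset.Icc 1 N, ‖iteratedDeriv (n + j) f.1 0‖ * w j :=
        (Summable.tsum_finsetSum fun n _ => summable_coeff_diffOp_pow f m n).symm
    _ ≤ ∑' j : ℕ, C * N * (((j : ℝ) + 3) * w j) := by
        refine Summable.tsum_le_tsum (fun j => ?_)
          (summable_sum fun n _ => summable_coeff_diffOp_pow f m n) (hs.mul_left _)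
        rw [← Finset.sum_mul, ← mul_assoc]
        refine mul_le_mul_of_nonneg_right ?_ (hw0 j)
        have h1 : ∑ n ∈ Finset.Icc 1 N, ‖iteratedDeriv (n + j) f.1 0‖ ≤
            ∑ n ∈ Finset.range (N + j + 1), ‖iteratedDeriv n f.1 0‖ := by
          refine (Finset.sum_map (Finset.Icc 1 N) (addRightEmbedding j)
            (fun n => ‖iteratedDeriv n f.1 0‖)).symm.trans_le ?_
          refine Finset.sum_le_sum_of_subset_of_nonneg ?_ fun _ _ _ => norm_nonneg _
          intro n hn
          simp only [Finset.mem_map, Finset.mem_Icc, addRightEmbedding_apply,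
            Finset.mem_range] at hn ⊢
          omega
        refine (h1.trans (hC _)).trans ?_
        rw [mul_assoc]
        refine mul_le_mul_of_nonneg_left ?_ hC0
        have : (1 : ℝ) ≤ N := by exact_mod_cast hN
        push_cast
        nlinarith [(Nat.cast_nonneg j : (0 : ℝ) ≤ j)]
    _ = _ := by
        rw [tsum_mul_left]
        ring

end Density

/-! ### Coefficient sums bounded by duality and Hölder's inequality. -/

section Duality

open MeasureTheory

theorem integral_norm_sq_tsum_angleMeasure {c : ℕ → ℂ} (hc : Summable fun n => ‖c n‖) :
    HasSum (fun n => ‖c n‖ ^ 2)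
      (∫ t : ℝ, ‖∑' n, c n * Complex.exp (t * Complex.I) ^ n‖ ^ 2 ∂angleMeasure) := by
  rw [integral_angleMeasure]
  refine ((integral_norm_sq_tsum hc).mul_left (1 / (2 * Real.pi))).congr_fun fun n => ?_
  have := Real.pi_ne_zero
  field_simp

/-- Hölder's inequality against a function bounded by `S` whose square has mean at most
`S ^ 2 / L`. -/
theorem integral_mul_le_of_sq_le {F G : ℝ → ℝ} (hF : Continuous F) (hG : Continuous G)
    (hF0 : ∀ t, 0 ≤ F t) (hG0 : ∀ t, 0 ≤ G t) {V L : ℝ} (hV : 0 ≤ V) (hL : 0 < L)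
    (hGS : ∀ t, G t ≤ L * V) (hG2 : ∫ t, G t ^ 2 ∂angleMeasure ≤ L * V ^ 2)
    {p : ℝ} (hp1 : 1 ≤ p) (hp2 : p ≤ 2) :
    ∫ t, F t * G t ∂angleMeasure ≤
      (∫ t, F t ^ p ∂angleMeasure) ^ (1 / p) * (V * L ^ (1 / p)) := by
  -- For `p = 1` the conjugate exponent is infinite, and the sup bound on `G` suffices.
  rcases hp1.eq_or_lt with rfl | hp1
  · simp only [Real.rpow_one, div_one]
    rw [← integral_mul_const]
    refine integral_mono_of_nonneg (Eventually.of_forall fun t => mul_nonneg (hF0 t) (hG0 t))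
      (memLp_one_iff_integrable.1 (memLp_angleMeasure (by fun_prop) 1))
      (Eventually.of_forall fun t => ?_)
    dsimp only
    rw [mul_comm V L]
    exact mul_le_mul_of_nonneg_left (hGS t) (hF0 t)
  · have hpq := Real.HolderConjugate.conjExponent hp1
    set q := p.conjExponent with hq
    have hq2 : 2 ≤ q := by
      rw [hq, Real.conjExponent, le_div_iff₀ (by linarith)]
      linarith
    have hq0 : 0 < q := by linarith
    refine (integral_mul_le_Lp_mul_Lq_of_nonneg hpq (Eventually.of_forall hF0)
      (Eventually.of_forall hG0) (memLp_angleMeasure hF _) (memLp_angleMeasure hG _)).trans ?_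
    refine mul_le_mul_of_nonneg_left ?_ (Real.rpow_nonneg
      (integral_nonneg fun t => Real.rpow_nonneg (hF0 t) _) _)
    -- Since `q ≥ 2`, all but two of the powers of `G` go to the sup bound and the rest to the
    -- quadratic mean.
    have h1 : ∫ t, G t ^ q ∂angleMeasure ≤ L ^ (q - 1) * V ^ q := by
      calc _ ≤ ∫ t, (L * V) ^ (q - 2) * G t ^ 2 ∂angleMeasure := by
            refine integral_mono_of_nonneg (Eventually.of_forall fun t => by
              have := hG0 t
              positivity) ?_ (Eventually.of_forall fun t => ?_)
            · exact memLp_one_iff_integrable.1 (memLp_angleMeasure (by fun_prop) 1)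
            · dsimp only
              have : q = (q - 2) + (2 : ℕ) := by push_cast; ring
              nth_rw 1 [this]
              rw [Real.rpow_add_natCast' (hG0 t) (by push_cast; linarith)]
              have := hG0 t
              gcongr
              exact hGS t
        _ ≤ (L * V) ^ (q - 2) * (L * V ^ 2) := by
            rw [integral_const_mul]
            gcongr
        _ = L ^ (q - 1) * V ^ q := by
            rw [Real.mul_rpow hL.le hV]
            have e1 : q - 1 = (q - 2) + 1 := by ring
            have e2 : V ^ q = V ^ (q - 2) * V ^ 2 := by
              rw [← Real.rpow_add_natCast' hV (by push_cast; linarith)]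
              congr 1
              push_cast
              ring
            rw [e1, Real.rpow_add hL, Real.rpow_one, e2]
            ring
    calc _ ≤ (L ^ (q - 1) * V ^ q) ^ (1 / q) :=
          Real.rpow_le_rpow (integral_nonneg fun t => Real.rpow_nonneg (hG0 t) _) h1
            (by positivity)
      _ = V * L ^ (1 / p) := by
          rw [Real.mul_rpow (by positivity) (by positivity), ← Real.rpow_mul hL.le,
            ← Real.rpow_mul hV, mul_one_div_cancel hq0.ne', Real.rpow_one, mul_comm]
          congr 2
          have := hpq.inv_add_inv_eq_one
          field_simp at this ⊢
          linarith

/-- The weighted sum of finitely many Fourier coefficients of an absolutely convergent series is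
controlled by its mean of order `p ∈ [1, 2]`. -/
theorem sum_weight_mul_norm_le {c : ℕ → ℂ} (hc : Summable fun n => ‖c n‖) {W : Finset ℕ}
    (hW : W.Nonempty) {v : ℕ → ℝ} {V : ℝ} (hv0 : ∀ n, 0 ≤ v n) (hvV : ∀ n ∈ W, v n ≤ V)
    {p : ℝ} (hp1 : 1 ≤ p) (hp2 : p ≤ 2) :
    ∑ n ∈ W, v n * ‖c n‖ ≤
      (∫ t : ℝ, ‖∑' n, c n * Complex.exp (t * Complex.I) ^ n‖ ^ p ∂angleMeasure) ^ (1 / p) *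
        (V * (W.card : ℝ) ^ (1 / p)) := by
  classical
  have hV : 0 ≤ V := by
    obtain ⟨n, hn⟩ := hW
    exact (hv0 n).trans (hvV n hn)
  -- The phase of `c n`, which is `0` where `c n = 0`. Pairing `F` with the polynomial `G` with
  -- coefficients `v n * ε n` on `W` produces the weighted sum of the `‖c n‖`.
  set ε : ℕ → ℂ := fun n => c n / ‖c n‖ with hε
  have hε1 : ∀ n, ‖ε n‖ ≤ 1 := fun n => by
    simp only [hε, norm_div, Complex.norm_real, norm_norm]
    exact div_self_le_one _
  have hεc : ∀ n, c n * (starRingEnd ℂ) (ε n) = ‖c n‖ := fun n => by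
    simp only [hε, map_div₀, Complex.conj_ofReal]
    rw [← mul_div_assoc, Complex.mul_conj, Complex.normSq_eq_norm_sq]
    push_cast
    rw [pow_two, mul_self_div_self]
  set d : ℕ → ℂ := fun n => if n ∈ W then v n * ε n else 0 with hd
  have hdV : ∀ n, ‖d n‖ ≤ V := fun n => by
    simp only [hd]
    split_ifs with hn
    · rw [norm_mul, Complex.norm_real, Real.norm_of_nonneg (hv0 n)]
      exact (mul_le_of_le_one_right (hv0 n) (hε1 n)).trans (hvV n hn)
    · simpa using hV
  have hd0 : ∀ n ∉ W, d n = 0 := fun n hn => if_neg hn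
  have hdsum : Summable fun n => ‖d n‖ :=
    summable_of_ne_finset_zero (s := W) fun n hn => by simp [hd0 n hn]
  set F : ℝ → ℂ := fun t => ∑' n, c n * Complex.exp (t * Complex.I) ^ n with hF
  set G : ℝ → ℂ := fun t => ∑' n, d n * Complex.exp (t * Complex.I) ^ n with hG
  have hFc : Continuous F := continuous_tsum_mul_exp_I_pow hc
  have hGc : Continuous G := continuous_tsum_mul_exp_I_pow hdsum
  have hGfin : ∀ t : ℝ, G t = ∑ n ∈ W, d n * Complex.exp (t * Complex.I) ^ n := fun t =>
    tsum_eq_sum fun n hn => by simp [hd0 n hn]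
  have hGS : ∀ t, ‖G t‖ ≤ W.card * V := fun t => by
    rw [hGfin, ← nsmul_eq_mul]
    refine (norm_sum_le _ _).trans (Finset.sum_le_card_nsmul _ _ _ fun n _ => ?_)
    simpa [Complex.norm_exp_ofReal_mul_I] using hdV n
  have hG2 : ∫ t, ‖G t‖ ^ 2 ∂angleMeasure ≤ W.card * V ^ 2 := by
    rw [← (integral_norm_sq_tsum_angleMeasure hdsum).tsum_eq,
      tsum_eq_sum (s := W) fun n hn => by simp [hd0 n hn], ← nsmul_eq_mul]
    exact Finset.sum_le_card_nsmul _ _ _ fun n _ => by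
      have := hdV n
      gcongr
  have hpair : ∫ t in (0 : ℝ)..(2 * Real.pi), F t * (starRingEnd ℂ) (G t) =
      2 * Real.pi * ((∑ n ∈ W, v n * ‖c n‖ : ℝ) : ℂ) := by
    have : ∀ t : ℝ, F t * (starRingEnd ℂ) (G t) = ∑ n ∈ W, (starRingEnd ℂ) (d n) *
        (F t * (starRingEnd ℂ) (Complex.exp (t * Complex.I) ^ n)) := fun t => by
      rw [hGfin, map_sum, Finset.mul_sum]
      refine Finset.sum_congr rfl fun n _ => ?_
      rw [map_mul]
      ring
    simp_rw [this]
    rw [intervalIntegral.integral_finsetSum fun n _ =>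
      Continuous.intervalIntegrable (by fun_prop) _ _]
    push_cast
    rw [Finset.mul_sum]
    refine Finset.sum_congr rfl fun n hn => ?_
    rw [intervalIntegral.integral_const_mul, integral_tsum_mul_conj_pow hc, ← hεc n]
    simp only [hd, if_pos hn, map_mul, Complex.conj_ofReal]
    ring
  have hle : ∑ n ∈ W, v n * ‖c n‖ ≤ ∫ t, ‖F t‖ * ‖G t‖ ∂angleMeasure := by
    have h1 := intervalIntegral.norm_integral_le_integral_norm (μ := volume)
      (f := fun t => F t * (starRingEnd ℂ) (G t)) (a := 0) (b := 2 * Real.pi) (by positivity)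
    rw [hpair] at h1
    have h2 : 0 ≤ ∑ n ∈ W, v n * ‖c n‖ :=
      Finset.sum_nonneg fun n _ => mul_nonneg (hv0 n) (norm_nonneg _)
    simp only [norm_mul, RCLike.norm_conj, Complex.norm_real, Complex.norm_ofNat,
      Real.norm_of_nonneg h2, Real.norm_of_nonneg Real.pi_pos.le] at h1
    rw [integral_angleMeasure, one_div, ← div_eq_inv_mul, le_div_iff₀ (by positivity)]
    linarith
  exact hle.trans (integral_mul_le_of_sq_le hFc.norm hGc.norm (fun t => norm_nonneg _)
    (fun t => norm_nonneg _) hV (by exact_mod_cast hW.card_pos) hGS hG2 hp1 hp2)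

end Duality

/-! ### Nonexistence: windows between consecutive squares. -/

section Windows

/-- The Stirling sequence `n! / (√(2n) (n/e)^n)` decreases from its value `e / √2` at `n = 1`. -/
theorem factorial_le_exp_mul_sqrt_mul (n : ℕ) (hn : n ≠ 0) :
    (n.factorial : ℝ) ≤ Real.exp 1 * √n * (n / Real.exp 1) ^ n := by
  obtain ⟨m, rfl⟩ := Nat.exists_eq_succ_of_ne_zero hn
  have h := Stirling.stirlingSeq'_antitone (Nat.zero_le m)
  simp only [Function.comp, Nat.succ_eq_add_one, zero_add, Stirling.stirlingSeq_one] at h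
  rw [Stirling.stirlingSeq, div_le_iff₀ (by positivity)] at h
  refine h.trans_eq ?_
  rw [Real.sqrt_mul (by norm_num)]
  have : √(2 : ℝ) ≠ 0 := by positivity
  field_simp

/-- At `j = 0` Stirling gives `e k e^{-k^2}`. Each of the at most `2k` further factors is at most `1
+ 2/k ≤ e^{2/k}`, so together they cost at most `e^4`. -/
theorem factorial_div_pow_le {k j : ℕ} (hk : 1 ≤ k) (hj : j ≤ 2 * k) :
    ((k ^ 2 + j).factorial : ℝ) / ((k : ℝ) ^ 2) ^ (k ^ 2 + j) ≤
      Real.exp 5 * k * Real.exp (-(k : ℝ) ^ 2) := by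
  have hk0 : (0 : ℝ) < k := by exact_mod_cast hk
  have hstep : ∀ i : ℕ, i ≤ 2 * k →
      ((k ^ 2 + i).factorial : ℝ) / ((k : ℝ) ^ 2) ^ (k ^ 2 + i) ≤
        ((k ^ 2).factorial : ℝ) / ((k : ℝ) ^ 2) ^ (k ^ 2) * Real.exp (2 / k) ^ i := by
    intro i
    induction i with
    | zero => simp
    | succ i ih =>
      intro hi
      have h1 : ((k ^ 2 + i + 1 : ℕ) : ℝ) / (k : ℝ) ^ 2 ≤ Real.exp (2 / k) := by
        refine le_trans ?_ (Real.add_one_le_exp _)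
        have : ((i + 1 : ℕ) : ℝ) ≤ 2 * k := by exact_mod_cast hi
        push_cast at this ⊢
        rw [div_le_iff₀ (by positivity)]
        have e : (2 / (k : ℝ) + 1) * (k : ℝ) ^ 2 = 2 * k + (k : ℝ) ^ 2 := by field_simp
        rw [e]
        linarith
      rw [← add_assoc, Nat.factorial_succ, pow_succ ((k : ℝ) ^ 2), pow_succ (Real.exp _),
        ← mul_assoc]
      calc _ = ((k ^ 2 + i).factorial : ℝ) / ((k : ℝ) ^ 2) ^ (k ^ 2 + i) *
            (((k ^ 2 + i + 1 : ℕ) : ℝ) / (k : ℝ) ^ 2) := by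
            push_cast
            field_simp
        _ ≤ _ := mul_le_mul (ih (by omega)) h1 (by positivity) (by positivity)
  refine (hstep j hj).trans ?_
  have h4 : Real.exp (2 / k) ^ j ≤ Real.exp 4 := by
    rw [← Real.exp_nat_mul]
    refine Real.exp_le_exp.2 ?_
    have : (j : ℝ) ≤ 2 * k := by exact_mod_cast hj
    rw [mul_div_assoc', div_le_iff₀ hk0]
    linarith
  have h5 : ((k ^ 2).factorial : ℝ) / ((k : ℝ) ^ 2) ^ (k ^ 2) ≤
      Real.exp 1 * k * Real.exp (-(k : ℝ) ^ 2) := by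
    have := factorial_le_exp_mul_sqrt_mul (k ^ 2) (by positivity)
    push_cast at this
    rw [Real.sqrt_sq hk0.le, div_pow, Real.exp_one_pow] at this
    rw [div_le_iff₀ (by positivity)]
    refine this.trans_eq ?_
    push_cast
    rw [Real.exp_neg]
    ring
  calc _ ≤ Real.exp 1 * k * Real.exp (-(k : ℝ) ^ 2) * Real.exp 4 := by gcongr
    _ = _ := by
      have : Real.exp 5 = Real.exp 1 * Real.exp 4 := by rw [← Real.exp_add]; norm_num
      rw [this]
      ring

/-- In the duality bound the mean contributes `e^{k^2} / k^{1/p}`, the weights `k e^{-k^2}`, and the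
window length `(2k + 1)^{1/p} ≤ 3 k^{1/p}`. Only a multiple of `k` survives. -/
theorem sum_window_le {f : EntireFunctions} {p : ℝ≥0∞} (hp1 : 1 ≤ p) (hp2 : p ≤ 2) {k : ℕ}
    (hk : 1 ≤ k) {c : ℝ} (hc : 0 < c)
    (h : avgNorm p f.1 ((k : ℝ) ^ 2) ≤
      c * (Real.exp ((k : ℝ) ^ 2) / ((k : ℝ) ^ 2) ^ (1 / (2 * p.toReal)))) :
    ∑ j ∈ Finset.range (2 * k + 1), ‖iteratedDeriv (k ^ 2 + j) f.1 0‖ ≤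
      3 * c * Real.exp 5 * k := by
  have hk0 : (0 : ℝ) < k := by exact_mod_cast hk
  have hk1 : (1 : ℝ) ≤ k := by exact_mod_cast hk
  have hp : p ≠ ∞ := ne_top_of_le_ne_top (by norm_num) hp2
  have hp1' : 1 ≤ p.toReal := by simpa using ENNReal.toReal_mono hp hp1
  have hp2' : p.toReal ≤ 2 := by simpa using ENNReal.toReal_mono (by norm_num) hp2
  set W : Finset ℕ := (Finset.range (2 * k + 1)).map (addLeftEmbedding (k ^ 2)) with hW
  have hcard : W.card = 2 * k + 1 := by simp [hW]
  have key := sum_weight_mul_norm_le (EntireFunctions.summable_norm f ((k : ℝ) ^ 2)) (W := W)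
    (Finset.card_pos.1 (by omega)) (v := fun n => (n.factorial : ℝ) / ((k : ℝ) ^ 2) ^ n)
    (V := Real.exp 5 * k * Real.exp (-(k : ℝ) ^ 2)) (fun n => by positivity)
    (fun n hn => by
      simp only [hW, Finset.mem_map, Finset.mem_range, addLeftEmbedding_apply] at hn
      obtain ⟨j, hj, rfl⟩ := hn
      exact factorial_div_pow_le hk (by omega)) hp1' hp2'
  simp_rw [← EntireFunctions.circle_eq_tsum f] at key
  rw [← avgNorm_eq_integral hp, hcard] at key
  have hterm : ∀ n : ℕ, (n.factorial : ℝ) / ((k : ℝ) ^ 2) ^ n *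
      ‖iteratedDeriv n f.1 0 / n.factorial * (((k : ℝ) ^ 2 : ℝ) : ℂ) ^ n‖ =
        ‖iteratedDeriv n f.1 0‖ := fun n => by
    simp only [norm_mul, norm_div, norm_pow, Complex.norm_natCast, Complex.norm_real,
      Real.norm_of_nonneg hk0.le]
    field_simp
  simp_rw [hterm] at key
  rw [hW, Finset.sum_map] at key
  refine key.trans ?_
  set s := 1 / p.toReal with hs
  have hs1 : s ≤ 1 := by
    rw [hs, div_le_one (by linarith)]
    exact hp1'
  have hs0 : 0 ≤ s := by positivity
  have hpow : ((k : ℝ) ^ 2) ^ (1 / (2 * p.toReal)) = (k : ℝ) ^ s := by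
    rw [← Real.rpow_natCast, ← Real.rpow_mul hk0.le]
    congr 1
    rw [hs]
    push_cast
    field_simp
  rw [hpow] at h
  have hcardpow : ((2 * k + 1 : ℕ) : ℝ) ^ s ≤ 3 * (k : ℝ) ^ s := by
    calc ((2 * k + 1 : ℕ) : ℝ) ^ s ≤ (3 * k : ℝ) ^ s := by
          gcongr
          push_cast
          linarith
      _ = 3 ^ s * (k : ℝ) ^ s := Real.mul_rpow (by norm_num) hk0.le
      _ ≤ 3 ^ (1 : ℝ) * (k : ℝ) ^ s := by
          gcongr
          norm_num
      _ = _ := by rw [Real.rpow_one]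
  calc _ ≤ c * (Real.exp ((k : ℝ) ^ 2) / (k : ℝ) ^ s) *
        (Real.exp 5 * k * Real.exp (-(k : ℝ) ^ 2) * (3 * (k : ℝ) ^ s)) := by gcongr
    _ = _ := by
      rw [Real.exp_neg]
      have : (k : ℝ) ^ s ≠ 0 := by positivity
      field_simp

/-- The windows `[k^2, (k+1)^2)` tile the integers from `k₀^2` on, and bounds linear in `k` add up
to one of order `K^2`, that is, linear in the endpoint. -/
theorem sum_range_le_of_window {a : ℕ → ℝ} (ha : ∀ n, 0 ≤ a n) {C : ℝ} (hC : 0 ≤ C) {k₀ : ℕ}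
    (h : ∀ k, k₀ ≤ k → ∑ j ∈ Finset.range (2 * k + 1), a (k ^ 2 + j) ≤ C * k) :
    ∃ C' : ℝ, 0 ≤ C' ∧ ∀ N : ℕ, ∑ n ∈ Finset.range N, a n ≤ C' * (N + 1) := by
  set S := ∑ n ∈ Finset.range (k₀ ^ 2), a n with hS
  have hS0 : 0 ≤ S := Finset.sum_nonneg fun n _ => ha n
  have hsq : ∀ K, k₀ ≤ K → ∑ n ∈ Finset.range (K ^ 2), a n ≤ S + C * K ^ 2 := by
    intro K hK
    induction K, hK using Nat.le_induction with
    | base => nlinarith [sq_nonneg (k₀ : ℝ)]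
    | succ K hK ih =>
      rw [show (K + 1) ^ 2 = K ^ 2 + (2 * K + 1) by ring, Finset.sum_range_add]
      have := h K hK
      push_cast
      nlinarith [mul_nonneg hC (Nat.cast_nonneg K : (0 : ℝ) ≤ K)]
  refine ⟨S + C * k₀ ^ 2 + 3 * C, by positivity, fun N => ?_⟩
  set K := max k₀ (N.sqrt + 1) with hK
  have h1 : N ≤ K ^ 2 := by
    have h2 := Nat.lt_succ_sqrt' N
    have h3 : (N.sqrt + 1) ^ 2 ≤ K ^ 2 := Nat.pow_le_pow_left (le_max_right _ _) 2
    exact h2.le.trans h3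
  have h4 : K ^ 2 ≤ k₀ ^ 2 + 3 * (N + 1) := by
    have h5 : N.sqrt ^ 2 ≤ N := Nat.sqrt_le' N
    have h6 : N.sqrt ≤ N := Nat.sqrt_le_self N
    rcases max_choice k₀ (N.sqrt + 1) with h | h <;> rw [hK, h] <;> nlinarith
  have h7 : (K : ℝ) ^ 2 ≤ k₀ ^ 2 + 3 * (N + 1) := by exact_mod_cast h4
  calc ∑ n ∈ Finset.range N, a n ≤ ∑ n ∈ Finset.range (K ^ 2), a n :=
        Finset.sum_le_sum_of_subset_of_nonneg (Finset.range_mono h1) fun n _ _ => ha n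
    _ ≤ S + C * (k₀ ^ 2 + 3 * (N + 1)) := by
        refine (hsq K (le_max_left _ _)).trans ?_
        gcongr
    _ ≤ _ := by
        have hN : (0 : ℝ) ≤ N := Nat.cast_nonneg N
        nlinarith [mul_nonneg hS0 hN, mul_nonneg (mul_nonneg hC (sq_nonneg (k₀ : ℝ))) hN]

/-- Entire functions of slow growth are not distributionally unbounded for differentiation. -/
theorem not_distributionallyUnbounded_of_avgNorm_le {p : ℝ≥0∞} (hp1 : 1 ≤ p) (hp2 : p ≤ 2)
    {f : EntireFunctions} {c : ℝ} (hc : 0 < c)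
    (h : ∀ᶠ r : ℝ in atTop,
      avgNorm p f.1 r ≤ c * (Real.exp r / r ^ (1 / (2 * p.toReal)))) :
    ¬ DistributionallyUnbounded entireSeminorm diffOp f := by
  obtain ⟨R, hR⟩ := eventually_atTop.1 h
  have hwin : ∀ k : ℕ, max 1 ⌈R⌉₊ ≤ k →
      ∑ j ∈ Finset.range (2 * k + 1), ‖iteratedDeriv (k ^ 2 + j) f.1 0‖ ≤
        3 * c * Real.exp 5 * k := by
    intro k hk
    have hk1 : 1 ≤ k := (le_max_left _ _).trans hk
    have hk2 : R ≤ k := (Nat.le_ceil R).trans (by exact_mod_cast (le_max_right _ _).trans hk)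
    have hk1' : (1 : ℝ) ≤ k := by exact_mod_cast hk1
    exact sum_window_le hp1 hp2 hk1 hc (hR _ (by nlinarith))
  obtain ⟨C, hC0, hC⟩ := sum_range_le_of_window (a := fun n => ‖iteratedDeriv n f.1 0‖)
    (fun n => norm_nonneg _) (by positivity) hwin
  exact not_distributionallyUnbounded_of_sum_le hC0 hC

end Windows

/-! ### Existence: growth of functions with slowly growing coefficients. -/

section Construction

theorem EntireFunctions.exists_of_coeff {a : ℕ → ℂ} (ha : ∀ n, ‖a n‖ ≤ n) :
    ∃ f : EntireFunctions, ∀ n, iteratedDeriv n f.1 0 = a n := by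
  set p := FormalMultilinearSeries.ofScalars ℂ (fun n => a n / (n.factorial : ℂ)) with hp
  have hr : p.radius = ⊤ := by
    refine p.radius_eq_top_of_summable_norm fun r => ?_
    refine Summable.of_nonneg_of_le (fun n => by positivity) (fun n => ?_)
      (summable_natCast_mul_pow_div_factorial (r : ℝ))
    rw [hp, FormalMultilinearSeries.ofScalars_norm, norm_div, Complex.norm_natCast,
      div_mul_eq_mul_div, mul_div_assoc]
    exact mul_le_mul_of_nonneg_right (ha n) (by positivity)
  have h := p.hasFPowerSeriesOnBall (by rw [hr]; exact ENNReal.zero_lt_top)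
  have hd : Differentiable ℂ p.sum := by
    rw [← differentiableOn_univ]
    have := h.differentiableOn
    rwa [hr, Metric.eball_top] at this
  refine ⟨⟨p.sum, hd⟩, fun n => ?_⟩
  have h1 := h.factorial_smul 1 n
  rw [iteratedDeriv_eq_iteratedFDeriv, ← h1, hp, FormalMultilinearSeries.ofScalars_apply_eq]
  have : (n.factorial : ℂ) ≠ 0 := by exact_mod_cast n.factorial_ne_zero
  simp only [one_pow, nsmul_eq_mul, smul_eq_mul, mul_one]
  field_simp

theorem hasSum_pow_div_factorial (x : ℝ) :
    HasSum (fun n : ℕ => x ^ n / n.factorial) (Real.exp x) := by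
  rw [Real.exp_eq_exp_ℝ]
  exact NormedSpace.expSeries_div_hasSum_exp x

/-- Consecutive terms have ratio `r / (k + 1)`, which is at least `1` precisely while `k + 1 ≤ r`.
-/
theorem pow_div_factorial_le_floor {r : ℝ} (hr : 0 ≤ r) (n : ℕ) :
    r ^ n / n.factorial ≤ r ^ ⌊r⌋₊ / (⌊r⌋₊).factorial := by
  have hs : ∀ k : ℕ, r ^ (k + 1) / (k + 1).factorial = r ^ k / k.factorial * (r / (k + 1)) := by
    intro k
    rw [Nat.factorial_succ]
    push_cast
    field_simp
    ring
  rcases le_total n ⌊r⌋₊ with h | h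
  · induction h using Nat.decreasingInduction with
    | self => exact le_rfl
    | of_succ k hk ih =>
      refine le_trans ?_ ih
      rw [hs]
      refine le_mul_of_one_le_right (by positivity) ?_
      rw [one_le_div (by positivity)]
      have := Nat.floor_le hr
      have h2 : ((k + 1 : ℕ) : ℝ) ≤ ⌊r⌋₊ := by exact_mod_cast hk
      push_cast at h2
      linarith
  · induction n, h using Nat.le_induction with
    | base => exact le_rfl
    | succ k hk ih =>
      refine le_trans ?_ ih
      rw [hs]
      refine mul_le_of_le_one_right (by positivity) ?_
      rw [div_le_one (by positivity)]
      have := Nat.lt_floor_add_one r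
      have h2 : (⌊r⌋₊ : ℝ) ≤ k := by exact_mod_cast hk
      linarith

/-- At the maximal index `k = ⌊r⌋`, Stirling bounds `k!` below, while `x ≤ e^{x-1}` at `x = r / k`
gives `r^k ≤ e^r (k/e)^k`. The gain `√r` is the source of the exponent in the growth rate. -/
theorem pow_div_factorial_le_exp_div_sqrt {r : ℝ} (hr : 1 ≤ r) (n : ℕ) :
    r ^ n / n.factorial ≤ Real.exp r / √r := by
  refine (pow_div_factorial_le_floor (by linarith) n).trans ?_
  set k := ⌊r⌋₊ with hk
  have hk1 : 1 ≤ k := Nat.le_floor (by simpa using hr)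
  have hk1' : (1 : ℝ) ≤ k := by exact_mod_cast hk1
  have hk0 : (0 : ℝ) < k := by linarith
  have hrk : r < k + 1 := Nat.lt_floor_add_one r
  have h1 := Stirling.le_factorial_stirling k
  have h2 : √r ≤ √(2 * Real.pi * k) := by
    refine Real.sqrt_le_sqrt ?_
    nlinarith [Real.pi_gt_three]
  have h3 : r ^ k ≤ Real.exp r * (k / Real.exp 1) ^ k := by
    have h4 : r / k ≤ Real.exp (r / k - 1) := by
      have := Real.add_one_le_exp (r / k - 1)
      linarith
    have h5 : (r / k) ^ k ≤ Real.exp r / Real.exp 1 ^ k := by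
      calc (r / k) ^ k ≤ Real.exp (r / k - 1) ^ k := by gcongr
        _ = _ := by
          rw [← Real.exp_nat_mul, ← Real.exp_nat_mul, ← Real.exp_sub]
          congr 1
          field_simp
    rw [div_pow, div_le_iff₀ (by positivity)] at h5
    rw [div_pow]
    refine h5.trans_eq ?_
    ring
  have hsq : 0 < √r := Real.sqrt_pos.2 (by linarith)
  rw [div_le_div_iff₀ (by positivity) hsq]
  calc r ^ k * √r ≤ (Real.exp r * (k / Real.exp 1) ^ k) * √(2 * Real.pi * k) := by gcongr
    _ = Real.exp r * (√(2 * Real.pi * k) * (k / Real.exp 1) ^ k) := by ring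
    _ ≤ _ := by gcongr

theorem natCast_sq_le_of_lt {r : ℝ} {n : ℕ} (h : 27 * r < n) :
    (n : ℝ) ^ 2 ≤ Real.exp (-(27 * r)) * Real.exp 3 ^ n := by
  have h1 : (n : ℝ) ≤ Real.exp n := (by linarith : (n : ℝ) ≤ n + 1).trans (Real.add_one_le_exp _)
  calc (n : ℝ) ^ 2 ≤ Real.exp n ^ 2 := by gcongr
    _ = Real.exp ((2 : ℕ) * n) := (Real.exp_nat_mul _ _).symm
    _ ≤ Real.exp (-(27 * r) + n * 3) := Real.exp_le_exp.2 (by push_cast; linarith)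
    _ = _ := by rw [Real.exp_add, Real.exp_nat_mul]

theorem exp_three_le : Real.exp 3 ≤ 27 := by
  have h := Real.exp_one_lt_d9
  have : Real.exp 3 = Real.exp 1 ^ 3 := by rw [← Real.exp_nat_mul]; norm_num
  rw [this]
  calc Real.exp 1 ^ 3 ≤ 3 ^ 3 := by
        gcongr
        linarith
    _ = 27 := by norm_num

/-- An exponential sum whose coefficients grow slowly up to the index `27 r`. -/
theorem sum_sq_mul_pow_div_factorial_le {a : ℕ → ℕ} (ha : ∀ n, a n ≤ n) {r : ℝ} (hr : 0 ≤ r)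
    {K : ℕ} (hK : ∀ n : ℕ, (n : ℝ) ≤ 27 * r → a n ≤ K) :
    (Summable fun n => (a n : ℝ) ^ 2 * (r ^ n / n.factorial)) ∧
      ∑' n, (a n : ℝ) ^ 2 * (r ^ n / n.factorial) ≤ ((K : ℝ) ^ 2 + 1) * Real.exp r := by
  -- Beyond `27 r` the terms are dominated by a series with sum `e^{(e^3 - 27) r} ≤ 1`; this is why
  -- the cutoff is `27 ≥ e^3`.
  have hle : ∀ n, (a n : ℝ) ^ 2 * (r ^ n / n.factorial) ≤
      (K : ℝ) ^ 2 * (r ^ n / n.factorial) +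
        Real.exp (-(27 * r)) * ((Real.exp 3 * r) ^ n / n.factorial) := by
    intro n
    rcases le_or_gt (n : ℝ) (27 * r) with h | h
    · have h1 : (a n : ℝ) ≤ K := by exact_mod_cast hK n h
      have h2 : (a n : ℝ) ^ 2 * (r ^ n / n.factorial) ≤ (K : ℝ) ^ 2 * (r ^ n / n.factorial) := by
        gcongr
      exact h2.trans (le_add_of_nonneg_right (by positivity))
    · have h1 : (a n : ℝ) ^ 2 ≤ Real.exp (-(27 * r)) * Real.exp 3 ^ n := by
        refine le_trans ?_ (natCast_sq_le_of_lt h)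
        have : (a n : ℝ) ≤ n := by exact_mod_cast ha n
        gcongr
      refine le_trans ?_ (le_add_of_nonneg_left (by positivity))
      rw [mul_pow, mul_div_assoc, ← mul_assoc]
      gcongr
  have hs := ((hasSum_pow_div_factorial r).mul_left ((K : ℝ) ^ 2)).add
    ((hasSum_pow_div_factorial (Real.exp 3 * r)).mul_left (Real.exp (-(27 * r))))
  have hsum := Summable.of_nonneg_of_le (fun n => by positivity) hle hs.summable
  refine ⟨hsum, (hsum.tsum_le_tsum hle hs.summable).trans ?_⟩
  rw [hs.tsum_eq, ← Real.exp_add, add_mul, one_mul]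
  gcongr
  nlinarith [exp_three_le]

variable {f : EntireFunctions} {a : ℕ → ℕ}

/-- Growth of an entire function with slowly growing coefficients, for exponents `p ≥ 2`. -/
theorem avgNorm_le_of_coeff (hf : ∀ n, iteratedDeriv n f.1 0 = a n)
    (ha : ∀ n, a n ≤ n) {r : ℝ} (hr : 1 ≤ r) {K : ℕ} (hK : ∀ n : ℕ, (n : ℝ) ≤ 27 * r → a n ≤ K) :
    (∀ z : ℂ, ‖z‖ = r → ‖f.1 z‖ ≤ ((K : ℝ) ^ 2 + 1) * Real.exp r) ∧
      ∀ p : ℝ≥0∞, 2 ≤ p → p ≠ ∞ → avgNorm p f.1 r ≤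
        ((K : ℝ) ^ 2 + 1) * (Real.exp r / r ^ (1 / (2 * p.toReal))) := by
  have hr0 : 0 < r := by linarith
  obtain ⟨hs, hle⟩ := sum_sq_mul_pow_div_factorial_le ha hr0.le hK
  have hsup : ∀ z : ℂ, ‖z‖ = r → ‖f.1 z‖ ≤ ((K : ℝ) ^ 2 + 1) * Real.exp r := by
    intro z hz
    refine le_trans ?_ hle
    rw [← (EntireFunctions.hasSum f z).tsum_eq]
    refine tsum_of_norm_bounded hs.hasSum fun n => ?_
    rw [hf, norm_mul, norm_div, norm_pow, hz, Complex.norm_natCast, Complex.norm_natCast,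
      div_mul_eq_mul_div, mul_div_assoc]
    refine mul_le_mul_of_nonneg_right ?_ (by positivity)
    -- For natural numbers `a ≤ a^2`, so the bound on the square sum also controls the supremum.
    exact_mod_cast Nat.le_self_pow two_ne_zero (a n)
  refine ⟨hsup, fun p h2 hp => ?_⟩
  have h2' : 2 ≤ p.toReal := by
    simpa using ENNReal.toReal_mono hp h2
  set Λ : ℝ := (K : ℝ) ^ 2 + 1 with hΛ
  have hΛ1 : 1 ≤ Λ := by nlinarith [sq_nonneg (K : ℝ)]
  -- In Parseval's sum of `(a n)^2 (r^n / n!)^2`, one factor `r^n / n!` is replaced by its maximum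
  -- bound and the other is kept in the series.
  have hint : ∫ t, ‖f.1 (r * Complex.exp (t * Complex.I))‖ ^ 2 ∂angleMeasure ≤
      Real.exp r / √r * (Λ * Real.exp r) := by
    simp_rw [EntireFunctions.circle_eq_tsum f]
    rw [← (integral_norm_sq_tsum_angleMeasure (EntireFunctions.summable_norm f r)).tsum_eq]
    refine le_trans ?_ (mul_le_mul_of_nonneg_left hle (by positivity))
    rw [← tsum_mul_left]
    refine (integral_norm_sq_tsum_angleMeasure
      (EntireFunctions.summable_norm f r)).summable.tsum_le_tsum (fun n => ?_) (hs.mul_left _)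
    rw [hf, norm_mul, norm_div, norm_pow, Complex.norm_natCast, Complex.norm_natCast,
      Complex.norm_real, Real.norm_of_nonneg hr0.le, div_mul_eq_mul_div, mul_div_assoc, mul_pow,
      pow_two (r ^ n / (n.factorial : ℝ)), mul_left_comm]
    exact mul_le_mul_of_nonneg_right (pow_div_factorial_le_exp_div_sqrt hr n) (by positivity)
  refine (avgNorm_le_of_two_le h2 hp (Differentiable.continuous f.2) hr0.le hsup hint).trans ?_
  set s := p.toReal with hs'
  have hs0 : 0 < s := by linarith
  have hX : 0 < Λ * Real.exp r := by positivity
  have hM : (Λ * Real.exp r) ^ (s - 2) * (Real.exp r / √r * (Λ * Real.exp r)) ≤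
      (Λ * Real.exp r) ^ s / √r := by
    have e2 : (Λ * Real.exp r) ^ s = (Λ * Real.exp r) ^ (s - 2) * (Λ * Real.exp r) ^ 2 := by
      rw [← Real.rpow_add_natCast hX.ne']
      congr 1
      push_cast
      ring
    rw [e2, mul_div_assoc]
    refine mul_le_mul_of_nonneg_left ?_ (by positivity)
    rw [div_mul_eq_mul_div]
    refine div_le_div_of_nonneg_right ?_ (by positivity)
    rw [pow_two]
    refine mul_le_mul_of_nonneg_right ?_ hX.le
    exact le_mul_of_one_le_left (Real.exp_pos r).le hΛ1
  refine (Real.rpow_le_rpow (by positivity) hM (by positivity)).trans_eq ?_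
  rw [Real.div_rpow (by positivity) (by positivity), ← Real.rpow_mul hX.le,
    mul_one_div_cancel hs0.ne', Real.rpow_one, Real.sqrt_eq_rpow, ← Real.rpow_mul hr0.le,
    mul_div_assoc]
  congr 3
  field_simp

theorem avgNorm_le_max_of_coeff (hf : ∀ n, iteratedDeriv n f.1 0 = a n)
    (ha : ∀ n, a n ≤ n) {r : ℝ} (hr : 1 ≤ r) {K : ℕ} (hK : ∀ n : ℕ, (n : ℝ) ≤ 27 * r → a n ≤ K)
    {p : ℝ≥0∞} (hp1 : 1 ≤ p) :
    avgNorm p f.1 r ≤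
      ((K : ℝ) ^ 2 + 1) * (Real.exp r / r ^ (1 / (2 * max 2 p)).toReal) := by
  obtain ⟨h1, h2⟩ := avgNorm_le_of_coeff hf ha hr hK
  -- For `p = ∞` the exponent of `r` is `0` and the sup bound is enough.
  by_cases hp : p = ∞
  · subst hp
    simpa using avgNorm_top_le (by positivity) h1
  · have hmax : max 2 p ≠ ∞ := by simp [hp]
    refine (avgNorm_mono (zero_lt_one.trans_le hp1).ne' (le_max_right 2 p)
      (Differentiable.continuous f.2) (by linarith)).trans ((h2 _ (le_max_left _ _) hmax).trans_eq ?_)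
    rw [ENNReal.toReal_div, ENNReal.toReal_mul]
    simp

end Construction

/-! ### Existence: the block structure of the coefficients. -/

section Blocks

/-- The factor `2 (k + 1)` makes each block outweigh its predecessors, for the densities; the lower
bound `R` delays the value `k` until `φ` can pay for it. -/
theorem exists_block_sequence {φ : ℝ → ℝ} (hφ : Tendsto φ atTop atTop) :
    ∃ N : ℕ → ℕ, N 0 = 0 ∧ (∀ k, 2 * (k + 1) * N k + 1 ≤ N (k + 1)) ∧
      ∀ k, 1 ≤ k → ∀ r : ℝ, (N k : ℝ) ≤ 27 * r → (k : ℝ) ^ 2 + 1 ≤ φ r := by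
  have h : ∀ k : ℕ, ∃ R : ℕ, ∀ r : ℝ, (R : ℝ) ≤ 27 * r → (k : ℝ) ^ 2 + 1 ≤ φ r := by
    intro k
    obtain ⟨R, hR⟩ := eventually_atTop.1 (hφ.eventually_ge_atTop ((k : ℝ) ^ 2 + 1))
    refine ⟨⌈27 * R⌉₊, fun r hr => hR r ?_⟩
    have := Nat.le_ceil (27 * R)
    linarith
  choose R hR using h
  let N : ℕ → ℕ := fun k => Nat.rec 0 (fun k x => max (R (k + 1)) (2 * (k + 1) * x + 1)) k
  refine ⟨N, rfl, fun k => le_max_right _ _, fun k hk r hr => ?_⟩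
  obtain ⟨k, rfl⟩ := Nat.exists_eq_add_of_le' hk
  refine hR (k + 1) r (le_trans ?_ hr)
  exact_mod_cast le_max_left _ _

/-- The index of the block `[N k, N (k + 1))` that contains `n`. -/
def blockIndex (N : ℕ → ℕ) (n : ℕ) : ℕ := Nat.findGreatest (fun k => N k ≤ n) n

variable {N : ℕ → ℕ} (h0 : N 0 = 0) (hN : ∀ k, 2 * (k + 1) * N k + 1 ≤ N (k + 1))
include hN

theorem block_strictMono : StrictMono N := by
  refine strictMono_nat_of_lt_succ fun k => ?_
  nlinarith [hN k, Nat.zero_le (k * N k)]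

theorem le_blockIndex {k n : ℕ} (h : N k ≤ n) : k ≤ blockIndex N n :=
  Nat.le_findGreatest (((block_strictMono hN).le_apply).trans h) h

theorem lt_block_succ (n : ℕ) : n < N (blockIndex N n + 1) := by
  by_contra! h
  have := le_blockIndex hN h
  omega

theorem tendsto_blockIndex : Tendsto (blockIndex N) atTop atTop :=
  tendsto_atTop.2 fun k => by
    filter_upwards [eventually_ge_atTop (N k)] with n hn using le_blockIndex hN hn

omit hN in
include h0 in
theorem block_le (n : ℕ) : N (blockIndex N n) ≤ n :=
  Nat.findGreatest_spec (P := fun k => N k ≤ n) (Nat.zero_le n) (by simp [h0])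

omit hN in
theorem blockIndex_le (n : ℕ) : blockIndex N n ≤ n := Nat.findGreatest_le n

include h0

theorem blockIndex_eq {k n : ℕ} (h1 : N k ≤ n) (h2 : n < N (k + 1)) : blockIndex N n = k := by
  refine le_antisymm ?_ (le_blockIndex hN h1)
  have := (block_strictMono hN).lt_iff_lt.1 ((block_le h0 n).trans_lt h2)
  omega

theorem blockIndex_mono : Monotone (blockIndex N) := fun n _ h =>
  le_blockIndex hN ((block_le h0 n).trans h)

/-- `N` is strictly increasing in the integers, so the index rises by at most one per step. This
tames the coefficients that follow a block of zeros. -/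
theorem blockIndex_add_le (n j : ℕ) : blockIndex N (n + j) ≤ blockIndex N n + j := by
  have h1 := (block_strictMono hN).add_le_nat j (blockIndex N n + 1)
  rw [add_comm j (blockIndex N n + 1)] at h1
  have h2 := lt_block_succ hN n
  have h3 := block_le h0 (n + j)
  have h4 : N (blockIndex N (n + j)) < N (blockIndex N n + 1 + j) := by omega
  have := (block_strictMono hN).lt_iff_lt.1 h4
  omega

omit h0 in
-- Counted up to `N (k + 1)`, a block without its last `k` points misses at most `N k + k ≤ 2 N k`
-- numbers, a proportion below `1 / (k + 1)`.
theorem upperDensity_eq_one_of_blocks {A : Set ℕ}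
    (hA : ∃ᶠ k : ℕ in atTop, ∀ n, N k ≤ n → n + k < N (k + 1) → n ∈ A) :
    upperDensity A = 1 := by
  refine upperDensity_eq_one fun ε hε => ?_
  rw [frequently_atTop] at hA ⊢
  intro n₀
  obtain ⟨k, hk, hkA⟩ := hA (max (n₀ + 1) (⌈1 / ε⌉₊))
  have hk1 : n₀ + 1 ≤ k := (le_max_left _ _).trans hk
  have hkε : 1 / ε ≤ k := (Nat.le_ceil _).trans (by exact_mod_cast (le_max_right _ _).trans hk)
  have hkN : k ≤ N k := (block_strictMono hN).le_apply
  have hgrow := hN k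
  refine ⟨N (k + 1), ?_, ?_⟩
  · have := (block_strictMono hN).le_apply (x := k + 1)
    omega
  have hsub : ((Finset.Ico (N k) (N (k + 1) - k) : Finset ℕ) : Set ℕ) ⊆
      A ∩ Set.Icc 1 (N (k + 1)) := by
    intro n hn
    simp only [Finset.coe_Ico, Set.mem_Ico] at hn
    exact ⟨hkA n hn.1 (by omega), by simp only [Set.mem_Icc]; omega⟩
  have hcard := Set.ncard_le_ncard hsub ((Set.finite_Icc _ _).subset Set.inter_subset_right)
  rw [Set.ncard_coe_finset, Nat.card_Ico] at hcard
  have hcard2 : N (k + 1) ≤ (A ∩ Set.Icc 1 (N (k + 1))).ncard + 2 * N k := by omega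
  have hcard3 : (N (k + 1) : ℝ) ≤ (A ∩ Set.Icc 1 (N (k + 1))).ncard + 2 * N k := by
    exact_mod_cast hcard2
  have hgrow' : 2 * ((k : ℝ) + 1) * N k + 1 ≤ N (k + 1) := by exact_mod_cast hgrow
  have hpos : (0 : ℝ) < N (k + 1) := by nlinarith [Nat.cast_nonneg (α := ℝ) (N k)]
  rw [le_div_iff₀ hpos]
  have h1 : 1 ≤ ε * k := by
    rw [div_le_iff₀ hε] at hkε
    linarith
  have h2 : 2 * (N k : ℝ) ≤ ε * N (k + 1) := by
    have h3 : ε * (2 * ((k : ℝ) + 1) * N k) ≤ ε * N (k + 1) := by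
      gcongr
      linarith
    have h4 : 2 * (N k : ℝ) * 1 ≤ 2 * (N k : ℝ) * (ε * (k + 1)) := by
      gcongr
      nlinarith
    nlinarith
  linarith

/-- An entire function whose Taylor coefficients alternate between long blocks of zeros and long
blocks of slowly growing constants is distributionally irregular for differentiation. -/
theorem distributionallyIrregular_of_blocks {f : EntireFunctions}
    (hf : ∀ n, iteratedDeriv n f.1 0 =
      ((if Odd (blockIndex N n) then blockIndex N n else 0 : ℕ) : ℂ)) :
    DistributionallyIrregular entireSeminorm diffOp f := by
  have hω := tendsto_blockIndex hN
  constructor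
  -- The seminorm with `m = 0` already works: it dominates the value at `0`, which is the block
  -- index.
  · refine ⟨0, {n | Odd (blockIndex N n)}, upperDensity_eq_one_of_blocks hN ?_, ?_⟩
    · refine frequently_atTop.2 fun k => ⟨2 * k + 1, by omega, fun n h1 h2 => ?_⟩
      rw [Set.mem_ofPred_eq, blockIndex_eq h0 hN h1 (by omega)]
      exact odd_two_mul_add_one k
    · refine tendsto_atTop_mono' _ ?_
        ((tendsto_natCast_atTop_atTop (R := ℝ)).comp (hω.mono_left inf_le_left))
      rw [EventuallyLE, eventually_inf_principal]
      refine Eventually.of_forall fun n hn => ?_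
      refine le_trans (le_of_eq ?_) (norm_apply_zero_le_entireSeminorm _ 0)
      rw [Set.mem_ofPred_eq] at hn
      rw [diffOp_pow_apply, hf, if_pos hn, Complex.norm_natCast]
      rfl
  -- Staying away from the right end of an even block makes the first `blockIndex N n` coefficients
  -- of `D^n f` vanish.
  · refine ⟨{n | Even (blockIndex N n) ∧ n + blockIndex N n < N (blockIndex N n + 1)},
      upperDensity_eq_one_of_blocks hN ?_, fun m => ?_⟩
    · refine frequently_atTop.2 fun k => ⟨2 * k, by omega, fun n h1 h2 => ?_⟩
      rw [Set.mem_ofPred_eq, blockIndex_eq h0 hN h1 (by omega)]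
      exact ⟨even_two_mul k, h2⟩
    -- For `j ≥ blockIndex N n` the coefficient at `n + j` is at most `blockIndex N n + j ≤ 2j`, so
    -- only the tail of a fixed convergent series remains.
    · set w : ℕ → ℝ := fun j => 2 * ((j : ℝ) * ((m : ℝ) ^ j / j.factorial)) with hw
      have hws : Summable w := (summable_natCast_mul_pow_div_factorial m).mul_left 2
      have htail : Tendsto (fun n => ∑' j, w (j + blockIndex N n)) atTop (𝓝 0) :=
        (tendsto_sum_nat_add w).comp hω
      refine tendsto_of_tendsto_of_tendsto_of_le_of_le' tendsto_const_nhds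
        (htail.mono_left inf_le_left) (Eventually.of_forall fun n => apply_nonneg _ _) ?_
      rw [eventually_inf_principal]
      refine Eventually.of_forall fun n hn => ?_
      refine (entireSeminorm_diffOp_pow_le f m n).trans ?_
      have hsum := summable_coeff_diffOp_pow f m n
      rw [← hsum.sum_add_tsum_nat_add (blockIndex N n), Finset.sum_eq_zero, zero_add]
      · refine ((summable_nat_add_iff (blockIndex N n)).2 hsum).tsum_le_tsum (fun j => ?_)
          ((summable_nat_add_iff (blockIndex N n)).2 hws)
        simp only [hw]
        rw [← mul_assoc 2]
        refine mul_le_mul_of_nonneg_right ?_ (by positivity)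
        rw [hf, Complex.norm_natCast]
        have h1 := blockIndex_add_le h0 hN n (j + blockIndex N n)
        split_ifs
        · exact_mod_cast (by omega :
            blockIndex N (n + (j + blockIndex N n)) ≤ 2 * (j + blockIndex N n))
        · exact_mod_cast Nat.zero_le _
      · intro j hj
        rw [Finset.mem_range] at hj
        have h1 : blockIndex N (n + j) = blockIndex N n :=
          blockIndex_eq h0 hN ((block_le h0 n).trans (by omega)) (by have := hn.2; omega)
        rw [hf, h1, if_neg (Nat.not_odd_iff_even.2 hn.1)]
        simp

end Blocks

/-! ### Both parts of the theorem. -/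

theorem exists_distributionallyIrregular_avgNorm_le {φ : ℝ → ℝ} (hφ : Tendsto φ atTop atTop) :
    ∃ f : EntireFunctions, DistributionallyIrregular entireSeminorm diffOp f ∧
      ∀ p : ℝ≥0∞, 1 ≤ p → ∀ᶠ r : ℝ in atTop,
        avgNorm p f.1 r ≤ φ r * (Real.exp r / r ^ (1 / (2 * max 2 p)).toReal) := by
  obtain ⟨N, h0, hN, hNφ⟩ := exists_block_sequence hφ
  set a : ℕ → ℕ := fun n => if Odd (blockIndex N n) then blockIndex N n else 0 with ha
  have haω : ∀ n, a n ≤ blockIndex N n := fun n => by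
    simp only [ha]
    split_ifs <;> omega
  have han : ∀ n, a n ≤ n := fun n => (haω n).trans (blockIndex_le n)
  obtain ⟨f, hf⟩ := EntireFunctions.exists_of_coeff (a := fun n => (a n : ℂ)) fun n => by
    rw [Complex.norm_natCast]
    exact_mod_cast han n
  refine ⟨f, distributionallyIrregular_of_blocks h0 hN hf, fun p hp => ?_⟩
  -- The bound `K` is the index of the block containing `⌊27 r⌋`, so `N K ≤ 27 r` and `K^2 + 1 ≤ φ
  -- r`; `r ≥ N 1` ensures `K ≥ 1`.
  filter_upwards [eventually_ge_atTop 1, eventually_ge_atTop (N 1 : ℝ)] with r hr1 hr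
  have hfl : (⌊27 * r⌋₊ : ℝ) ≤ 27 * r := Nat.floor_le (by linarith)
  have hK : ∀ n : ℕ, (n : ℝ) ≤ 27 * r → a n ≤ blockIndex N ⌊27 * r⌋₊ := fun n hn =>
    (haω n).trans (blockIndex_mono h0 hN (Nat.le_floor hn))
  refine (avgNorm_le_max_of_coeff hf han hr1 hK hp).trans
    (mul_le_mul_of_nonneg_right (hNφ _ ?_ r ?_) (by positivity))
  · exact le_blockIndex hN (Nat.le_floor (by linarith))
  · refine le_trans ?_ hfl
    exact_mod_cast block_le h0 _

theorem mainTheorem1 (p : ℝ≥0∞) (hp : 1 ≤ p) :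
    (∀ φ : ℝ → ℝ, Tendsto φ atTop atTop →
      ∃ f : EntireFunctions, DistributionallyIrregular entireSeminorm diffOp f ∧
        ∀ᶠ r : ℝ in atTop,
          avgNorm p f.1 r ≤ φ r * (Real.exp r / r ^ (1 / (2 * max 2 p)).toReal)) ∧
    (¬ ∃ f : EntireFunctions, DistributionallyIrregular entireSeminorm diffOp f ∧
        ∃ c : ℝ, 0 < c ∧ ∀ᶠ r : ℝ in atTop,
          avgNorm p f.1 r ≤ c * (Real.exp r / r ^ (1 / (2 * min 2 p)).toReal)) := by
  refine ⟨fun φ hφ => ?_, ?_⟩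
  · obtain ⟨f, hf, h⟩ := exists_distributionallyIrregular_avgNorm_le hφ
    exact ⟨f, hf, h p hp⟩
  · rintro ⟨f, hf, c, hc, h⟩
    have h1 : 1 ≤ min 2 p := le_min (by norm_num) hp
    refine not_distributionallyUnbounded_of_avgNorm_le h1 (min_le_left 2 p) hc ?_ hf.1
    filter_upwards [h, eventually_ge_atTop 0] with r hr hr0
    refine (avgNorm_mono (zero_lt_one.trans_le h1).ne' (min_le_right 2 p)
      (Differentiable.continuous f.2) hr0).trans (hr.trans_eq ?_)
    rw [ENNReal.toReal_div, ENNReal.toReal_mul]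
    simp
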